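/- Let $\rho_*$ and $\sigma$ be positive definite $d\times d$ density matrices. Put $D(\rho\|\sigma)=\mathrm{Tr}\,\rho(\log\rho-\log\sigma)$ and $V(\rho\|\sigma)=\mathrm{Tr}\,\rho\,(\log\rho-\log\sigma-D(\rho\|\sigma)I)^2$. A full-parameter model through $\rho_*$ at $\theta_0$ is a family $\theta\mapsto\rho_\theta$, $\theta=(\theta^1,\dots,\theta^{d^2-1})\in\mathbb R^{d^2-1}$, of density matrices for $\theta$ near $\theta_0$, differentiable at $\theta_0$, with $\rho_{\theta_0}=\rho_*$ and linearly independent partial derivatives $\partial\rho_\theta/\partial\theta^j|_{\theta_0}$. An estimator is a POVM $E$ on a measurable space together with a measurable real-valued estimate $\hat g$ of the outcome. For a real function $g$ of $\theta$, the estimator is locally unbiased for $g$ at $\theta_0$ if the expectation $\mathbb E_\theta[\hat g]$ under the outcome distribution $\mathrm{Tr}\,\rho_\theta E(\cdot)$ exists near $\theta_0$, $\mathbb E_{\theta_0}[\hat g]=g(\theta_0)$, and $\mathbb E_\theta[\hat g]$ and $g(\theta)$ have the same partial derivatives at $\theta_0$ with respect to all $\theta^j$. The Cramér–Rao type bound for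 $g$ at $\theta_0$ is the infimum of the mean square error $\mathbb E_{\theta_0}[(\hat g-g(\theta_0))^2]$ over all locally unbiased estimators. (i) In every full-parameter model through $\rho_*$ at $\theta_0$, the Cramér–Rao type bound at $\theta_0$ for the estimation of $g(\theta)=D(\rho_\theta\|\sigma)$ ($\sigma$ known) equals $V(\rho_*\|\sigma)$, and it is attained: $V(\rho_*\|\sigma)$ is the minimal mean square error under local unbiasedness. (ii) Call a full-parameter model adapted (with parameter of interest $\theta^k$) if $\theta_0$ has $k$-th coordinate $D(\rho_*\|\sigma)$ and all other coordinates $0$, and $\partial D(\rho_\theta\|\sigma)/\partial\theta^j|_{\theta_0}$ is $1$ for $j=k$ and $0$ for $j\ne k$. In every adapted model the Cramér–Rao type bound for the parameter of interest $g(\theta)=\theta^k$, with all other parameters as nuisance parameters, equals $V(\rho_*\|\sigma)$ and is attained. (iii) If $V(\rho_*\|\sigma)\neq0$, then for each index $k$ there is an adapted full-parameter model with parameter of interest $\theta^k$ having symmetric logarithmic derivatives $L_j$ (Hermitian, $\partial\rho_\theta/\partial\theta^j|_{\theta_0}=(\rho_*L_j+L_j\rho_*)/2$) such that $\langle L_k,L_j\rangle_{\rho_*}=0$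 for $j\neq k$ and $\langle L_k,L_k\rangle_{\rho_*}^{-1}=V(\rho_*\|\sigma)$, where $\langle X,Y\rangle_\rho=\mathrm{Tr}\,\rho\,(XY+YX)/2$. -/

import Mathlib

open MeasureTheory Filter Topology
open scoped ENNReal ComplexOrder

noncomputable section

namespace QRelEnt

/-- Complex `d × d` matrices: operators on a `d`-dimensional quantum system. -/
abbrev Mat (d : ℕ) := Matrix (Fin d) (Fin d) ℂ

/-- Density matrices: positive semidefinite with trace one. -/
def IsState {d : ℕ} (ρ : Mat d) : Prop := ρ.PosSemidef ∧ ρ.trace = 1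

/-- The matrix (natural) logarithm of a Hermitian matrix, by functional calculus. -/
def matLog {d : ℕ} (A : Mat d) : Mat d := cfc Real.log A

/-- Quantum relative entropy `D(ρ‖σ) = Tr ρ (log ρ - log σ)`. -/
def relEntropy {d : ℕ} (ρ σ : Mat d) : ℝ :=
  (ρ * (matLog ρ - matLog σ)).trace.re

/-- Relative varentropy `V(ρ‖σ) = Tr ρ ((log ρ - log σ) - D(ρ‖σ))²`. -/
def relVarentropy {d : ℕ} (ρ σ : Mat d) : ℝ :=
  (ρ * (matLog ρ - matLog σ - ((relEntropy ρ σ : ℝ) : ℂ) • (1 : Mat d)) ^ 2).trace.re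

/-- Symmetrized product `X ∘ Y = (XY + YX)/2`. -/
def jordan {d : ℕ} (X Y : Mat d) : Mat d := (1 / 2 : ℂ) • (X * Y + Y * X)

/-- SLD inner product `⟨X, Y⟩_ρ = Tr ρ (X ∘ Y)` of Hermitian matrices. -/
def sldInner {d : ℕ} (ρ X Y : Mat d) : ℝ := (ρ * jordan X Y).trace.re

/-- A positive operator valued measure with values in the `d × d` matrices. -/
structure POVM (d : ℕ) (Ω : Type) [MeasurableSpace Ω] where
  effect : Set Ω → Mat d
  posSemidef : ∀ A, MeasurableSet A → (effect A).PosSemidef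
  univ : effect Set.univ = 1
  hasSum_iUnion : ∀ A : ℕ → Set Ω, (∀ i, MeasurableSet (A i)) →
    Pairwise (fun i j => Disjoint (A i) (A j)) →
    HasSum (fun i => effect (A i)) (effect (⋃ i, A i))

theorem POVM.empty {d : ℕ} {Ω : Type} [MeasurableSpace Ω] (E : POVM d Ω) :
    E.effect ∅ = 0 := by
  have h := E.hasSum_iUnion (fun _ => ∅) (fun _ => MeasurableSet.empty)
    (fun _ _ _ => by simp)
  exact (summable_const_iff _).mp h.summable

open scoped MatrixOrder in
theorem trace_mul_re_nonneg {d : ℕ} {ρ M : Mat d} (hρ : ρ.PosSemidef) (hM : M.PosSemidef) :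
    0 ≤ (ρ * M).trace.re := by
  obtain ⟨B, rfl⟩ := CStarAlgebra.nonneg_iff_eq_star_mul_self.mp hρ.nonneg
  have h := (hM.mul_mul_conjTranspose_same B).trace_nonneg
  rw [Matrix.mul_assoc, Matrix.trace_mul_comm, Matrix.star_eq_conjTranspose]
  exact (Complex.le_def.mp h).1

/-- Born rule: the outcome distribution `A ↦ Tr ρ E(A)` of the POVM `E` in the state `ρ`. It is
set to zero when `ρ` is not positive semidefinite. -/
def POVM.outcome {d : ℕ} {Ω : Type} [MeasurableSpace Ω] (E : POVM d Ω) (ρ : Mat d) :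
    Measure Ω :=
  open Classical in
  if hρ : ρ.PosSemidef then
    Measure.ofMeasurable (fun A _ => ENNReal.ofReal (ρ * E.effect A).trace.re)
      (by simp [E.empty])
      (by
        intro A hA hd
        have h1 : HasSum (fun i => (ρ * E.effect (A i)).trace.re)
            (ρ * E.effect (⋃ i, A i)).trace.re := by
          have h := E.hasSum_iUnion A hA hd
          have hc : Continuous (fun M : Mat d => (ρ * M).trace.re) :=
            Complex.continuous_re.comp ((continuous_const.matrix_mul continuous_id).matrix_trace)
          let f : Mat d →+ ℝ :=
            { toFun := fun M => (ρ * M).trace.re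
              map_zero' := by simp
              map_add' := by intro X Y; simp [Matrix.mul_add] }
          exact h.map f hc
        rw [← h1.tsum_eq, ENNReal.ofReal_tsum_of_nonneg _ h1.summable]
        exact fun i => trace_mul_re_nonneg hρ (E.posSemidef _ (hA i)))
  else 0

/-- Parameter space `ℝ^(d²-1)`. -/
abbrev Param (d : ℕ) := Fin (d ^ 2 - 1) → ℝ

/-- The `j`-th coordinate direction. -/
def coordVec {d : ℕ} (j : Fin (d ^ 2 - 1)) : Param d := Pi.single j 1

/-- The partial derivative `∂ρ_θ/∂θ^j` at `θ₀`, entrywise. -/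
def partialMat {d : ℕ} (ρ : Param d → Mat d) (θ₀ : Param d) (j : Fin (d ^ 2 - 1)) : Mat d :=
  Matrix.of fun a b => lineDeriv ℝ (fun θ => ρ θ a b) θ₀ (coordVec j)

/-- `θ ↦ ρ θ` is (near `θ₀`) a full-parameter model passing through `ρs` at `θ₀`: a family of
density matrices with `d² - 1` parameters, differentiable at `θ₀`, whose partial derivatives
there are linearly independent. -/
structure IsFullModel {d : ℕ} (ρ : Param d → Mat d) (θ₀ : Param d) (ρs : Mat d) : Prop where
  base : ρ θ₀ = ρs
  isState : ∀ᶠ θ in 𝓝 θ₀, IsState (ρ θ)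
  differentiable : ∀ a b, DifferentiableAt ℝ (fun θ => ρ θ a b) θ₀
  linearIndependent : LinearIndependent ℝ (partialMat ρ θ₀)

/-- Expectation of the estimate `est` when the POVM `E` is measured in the state `ρ`. -/
def mean {d : ℕ} {Ω : Type} [MeasurableSpace Ω] (E : POVM d Ω) (est : Ω → ℝ) (ρ : Mat d) : ℝ :=
  ∫ ω, est ω ∂(E.outcome ρ)

/-- Local unbiasedness at `θ₀` of the estimator `(E, est)` for the real quantity `g θ`: the
expectation of the estimate exists near `θ₀`, equals `g θ₀` at `θ₀`, and has there the same
partial derivatives as `g` with respect to all parameters. For the target `g θ = θ^k` this is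
local unbiasedness for the parameter of interest `θ^k` with the other parameters as nuisance
parameters: the partial derivatives are `1` in the `k`-th direction and `0` in the others. -/
structure IsLocallyUnbiased {d : ℕ} {Ω : Type} [MeasurableSpace Ω] (ρ : Param d → Mat d)
    (θ₀ : Param d) (g : Param d → ℝ) (E : POVM d Ω) (est : Ω → ℝ) : Prop where
  measurable : Measurable est
  integrable : ∀ᶠ θ in 𝓝 θ₀, Integrable est (E.outcome (ρ θ))
  value : mean E est (ρ θ₀) = g θ₀
  deriv : ∀ j, ∃ c : ℝ, HasLineDerivAt ℝ (fun θ => mean E est (ρ θ)) c θ₀ (coordVec j) ∧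
    HasLineDerivAt ℝ g c θ₀ (coordVec j)

/-- Mean square error at `θ₀` of `(E, est)` as an estimator of `g θ₀`, in `[0, ∞]`. -/
def mse {d : ℕ} {Ω : Type} [MeasurableSpace Ω] (ρ : Param d → Mat d)
    (θ₀ : Param d) (g : Param d → ℝ) (E : POVM d Ω) (est : Ω → ℝ) : ℝ≥0∞ :=
  ∫⁻ ω, ENNReal.ofReal ((est ω - g θ₀) ^ 2) ∂(E.outcome (ρ θ₀))

/-- The mean square errors of all locally unbiased estimators of `g` at `θ₀`. Only the law of the
estimate matters, so outcome spaces in the lowest universe suffice. -/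
def achievableMSE {d : ℕ} (ρ : Param d → Mat d) (θ₀ : Param d) (g : Param d → ℝ) :
    Set ℝ≥0∞ :=
  {v | ∃ (Ω : Type) (_ : MeasurableSpace Ω) (E : POVM d Ω) (est : Ω → ℝ),
    IsLocallyUnbiased ρ θ₀ g E est ∧ v = mse ρ θ₀ g E est}

/-- The Cramér–Rao type bound for the estimation of `g` at `θ₀` in the model `ρ`. -/
def crBound {d : ℕ} (ρ : Param d → Mat d) (θ₀ : Param d) (g : Param d → ℝ) : ℝ≥0∞ :=
  sInf (achievableMSE ρ θ₀ g)

/-- The parameterization `ρ` is adapted at `θ₀` to the function `f` of the state, with `θ^k` as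
parameter of interest: `θ₀` has `k`-th coordinate `f(ρ_{θ₀})` and other coordinates `0`, and at
`θ₀` the partial derivative of `f(ρ_θ)` is `1` in the `k`-th direction and `0` in the others. -/
structure IsAdapted {d : ℕ} (ρ : Param d → Mat d) (θ₀ : Param d) (f : Mat d → ℝ)
    (k : Fin (d ^ 2 - 1)) : Prop where
  base : θ₀ = Pi.single k (f (ρ θ₀))
  deriv_self : HasLineDerivAt ℝ (fun θ => f (ρ θ)) 1 θ₀ (coordVec k)
  deriv_other : ∀ j, j ≠ k → HasLineDerivAt ℝ (fun θ => f (ρ θ)) 0 θ₀ (coordVec j)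

/-- `L j` is the symmetric logarithmic derivative of the model at `θ₀` in the `j`-th direction:
Hermitian, with `∂ρ_θ/∂θ^j = ρ_{θ₀} ∘ L j` at `θ₀`. -/
def IsSLD {d : ℕ} (ρ : Param d → Mat d) (θ₀ : Param d)
    (L : Fin (d ^ 2 - 1) → Mat d) : Prop :=
  ∀ j, (L j).IsHermitian ∧ partialMat ρ θ₀ j = jordan (ρ θ₀) (L j)

end QRelEnt

end

open QRelEnt

/-! Everything is governed by the observable X = log ρ* − log σ − D(ρ*‖σ). It is Hermitian, Tr ρ*X =
0 and Tr ρ*X² = V. Moreover ∂_j D(ρ_θ‖σ) = Tr (∂_jρ)X (`hasDerivAt_relEntropy`). The derivative of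
log is never needed: D(ρ_θ‖ρ*) and D(ρ*‖ρ_θ) are nonnegative and their sum is Tr (ρ_θ − ρ*)(log ρ_θ
− log ρ*), which is of smaller order than θ − θ₀ along each line.

Lower bound. For a fixed estimator the mean is a real-linear function of the state
(`POVM.exists_linearMap_mean`). Since ρ* and the traceless ∂_jρ together form a basis of the
d²-dimensional space of Hermitian matrices, local unbiasedness forces the mean in the state H to be
Tr H(X + g(θ₀)) (`IsFullModel.linearMap_eq_of_isHermitian`). A quantum Cauchy–Schwarz inequality for
the outcome densities then gives mean square error at least Tr ρ*X²
(`POVM.ofReal_trace_mul_sq_le_lintegral`).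

Attainment. The spectral measurement of X, with estimate g(θ₀) plus the observed eigenvalue, is
locally unbiased and has error exactly Tr ρ*X² (`IsFullModel.mem_achievableMSE`). Both halves use g
only through its partial derivatives Tr (∂_jρ)X, so they cover θ^k in an adapted model as well.

Orthogonal model. Take L_k = X/V and complete it by independent Hermitian matrices that are centred
and SLD-orthogonal to X; the affine family with derivatives ρ* ∘ L_j is adapted. -/

noncomputable section

namespace QRelEnt

/-! ### Operator order near a positive definite matrix, and continuity of the logarithm. -/

section Order

open scoped MatrixOrder Matrix.Norms.L2Operator

variable {d : ℕ}

theorem exists_pos_posSemidef_sub_smul_one {A : Mat d} (hA : A.PosDef) :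
    ∃ c : ℝ, 0 < c ∧ (A - (c : ℂ) • (1 : Mat d)).PosSemidef := by
  rcases isEmpty_or_nonempty (Fin d) with h | h
  · refine ⟨1, one_pos, ?_⟩
    rw [Subsingleton.elim (A - _) 0]
    exact Matrix.PosSemidef.zero
  · obtain ⟨r, hr, hle⟩ := (CFC.exists_pos_algebraMap_le_iff (a := A) hA.isHermitian).2
      fun x hx => by
        rw [hA.isHermitian.spectrum_real_eq_range_eigenvalues] at hx
        obtain ⟨i, rfl⟩ := hx
        exact hA.eigenvalues_pos i
    refine ⟨r, hr, ?_⟩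
    have := Matrix.le_iff.mp hle
    rwa [Algebra.algebraMap_eq_smul_one, ← Complex.coe_smul] at this

theorem posSemidef_norm_smul_one_sub {H : Mat d} (hH : H.IsHermitian) :
    (((‖H‖ : ℝ) : ℂ) • (1 : Mat d) - H).PosSemidef := by
  have := Matrix.le_iff.mp (IsSelfAdjoint.le_algebraMap_norm_self (a := H) hH)
  rwa [Algebra.algebraMap_eq_smul_one, ← Complex.coe_smul] at this

theorem posSemidef_add_norm_smul_one {H : Mat d} (hH : H.IsHermitian) :
    (H + ((‖H‖ : ℝ) : ℂ) • (1 : Mat d)).PosSemidef := by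
  have := posSemidef_norm_smul_one_sub hH.neg
  rwa [norm_neg, sub_neg_eq_add, add_comm] at this

theorem posSemidef_smul_one {c : ℝ} (hc : 0 ≤ c) : ((c : ℂ) • (1 : Mat d)).PosSemidef :=
  Matrix.PosSemidef.one.smul (by exact_mod_cast hc)

/-- If A ≥ r > 0, then (‖H‖/r) A ≥ ‖H‖ ≥ H. Through this bound a faithful state dominates all other
outcome laws. -/
theorem exists_posSemidef_smul_sub {A : Mat d} (hA : A.PosDef) {H : Mat d}
    (hH : H.IsHermitian) : ∃ c : ℝ, 0 ≤ c ∧ ((c : ℂ) • A - H).PosSemidef := by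
  obtain ⟨r, hr, hr'⟩ := exists_pos_posSemidef_sub_smul_one hA
  refine ⟨‖H‖ / r, by positivity, ?_⟩
  have h1 : (((‖H‖ / r : ℝ) : ℂ) • (A - (r : ℂ) • (1 : Mat d))).PosSemidef :=
    hr'.smul (by exact_mod_cast (by positivity : (0 : ℝ) ≤ ‖H‖ / r))
  have h2 := h1.add (posSemidef_norm_smul_one_sub hH)
  have hr0 : (r : ℂ) ≠ 0 := by exact_mod_cast hr.ne'
  convert h2 using 1
  rw [smul_sub, smul_smul]
  push_cast
  rw [div_mul_cancel₀ _ hr0]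
  abel

theorem eventually_posSemidef_sub_smul_one {ι : Type*} {l : Filter ι} {A : Mat d}
    (hA : A.PosDef) {B : ι → Mat d} (hB : Tendsto B l (𝓝 A))
    (hH : ∀ᶠ x in l, (B x).IsHermitian) :
    ∃ c : ℝ, 0 < c ∧ ∀ᶠ x in l, (B x - (c : ℂ) • (1 : Mat d)).PosSemidef := by
  obtain ⟨r, hr, hr'⟩ := exists_pos_posSemidef_sub_smul_one hA
  -- A ≥ r, and a Hermitian perturbation of norm below r/2 costs at most r/2.
  refine ⟨r / 2, by positivity, ?_⟩
  have hn : Tendsto (fun x => ‖B x - A‖) l (𝓝 0) := by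
    simpa using (hB.sub_const A).norm
  filter_upwards [hH, hn.eventually (gt_mem_nhds (half_pos hr))] with x hx hlt
  have h1 := posSemidef_add_norm_smul_one (hx.sub hA.isHermitian)
  have h2 := posSemidef_smul_one (d := d) (sub_nonneg.2 hlt.le)
  convert (hr'.add h1).add h2 using 1
  push_cast
  module

theorem eventually_posDef {ι : Type*} {l : Filter ι} {A : Mat d}
    (hA : A.PosDef) {B : ι → Mat d} (hB : Tendsto B l (𝓝 A))
    (hH : ∀ᶠ x in l, (B x).IsHermitian) : ∀ᶠ x in l, (B x).PosDef := by
  obtain ⟨c, hc, h⟩ := eventually_posSemidef_sub_smul_one hA hB hH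
  filter_upwards [h] with x hx
  have : ((c : ℂ) • (1 : Mat d)).PosDef :=
    Matrix.PosDef.one.smul (by exact_mod_cast hc)
  simpa using Matrix.PosDef.posSemidef_add hx this

/-- The spectra eventually lie in one compact interval bounded away from 0, on which log is
continuous, so continuity of the functional calculus applies. -/
theorem tendsto_matLog {ι : Type*} {l : Filter ι} {A : Mat d}
    (hA : A.PosDef) {B : ι → Mat d} (hB : Tendsto B l (𝓝 A))
    (hH : ∀ᶠ x in l, (B x).IsHermitian) :
    Tendsto (fun x => matLog (B x)) l (𝓝 (matLog A)) := by
  obtain ⟨c, hc, h⟩ := eventually_posSemidef_sub_smul_one hA hB hH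
  obtain ⟨c', hc', h'⟩ := exists_pos_posSemidef_sub_smul_one hA
  have key : ∀ (e : ℝ) (M : Mat d), M.IsHermitian → (M - (e : ℂ) • (1 : Mat d)).PosSemidef →
      ∀ x ∈ spectrum ℝ M, e ≤ x := by
    intro e M hM hp
    refine (algebraMap_le_iff_le_spectrum (a := M) hM).1 ?_
    rw [Matrix.le_iff, Algebra.algebraMap_eq_smul_one, ← Complex.coe_smul]
    exact hp
  have key' : ∀ M : Mat d, M.IsHermitian → ∀ x ∈ spectrum ℝ M, x ≤ ‖M‖ := fun M hM =>
    (le_algebraMap_iff_spectrum_le (a := M) hM).1 (IsSelfAdjoint.le_algebraMap_norm_self hM)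
  have hn : Tendsto (fun x => ‖B x‖) l (𝓝 ‖A‖) := hB.norm
  have hs : IsCompact (Set.Icc (min c c') (‖A‖ + 1)) := isCompact_Icc
  refine Filter.Tendsto.cfc hs Real.log hB ?_ (hH.mono fun x hx => hx) ?_ hA.isHermitian ?_
  · filter_upwards [h, hH, hn.eventually (gt_mem_nhds (lt_add_one _))] with x hx hHx hlt y hy
    refine ⟨(min_le_left _ _).trans (key c _ hHx hx y hy), ?_⟩
    exact (key' _ hHx y hy).trans hlt.le
  · intro y hy
    refine ⟨(min_le_right _ _).trans (key c' _ hA.isHermitian h' y hy), ?_⟩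
    exact (key' _ hA.isHermitian y hy).trans (by linarith)
  · refine Real.continuousOn_log.mono fun x hx => ?_
    exact ((lt_min hc hc').trans_le hx.1).ne'

end Order

/-! ### Klein's inequality: nonnegativity of relative entropy. -/

section Trace

variable {d : ℕ}

theorem isHermitian_matLog (A : Mat d) : (matLog A).IsHermitian :=
  IsSelfAdjoint.cfc

/-- Expanding in the two eigenbases leaves the nonnegative weights |⟨u_i, v_j⟩|², which do not
depend on f and g. Trace inequalities thus reduce to scalar ones. -/
theorem trace_cfc_mul_cfc {A B : Mat d} (hA : A.IsHermitian) (hB : B.IsHermitian)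
    (f g : ℝ → ℝ) :
    (cfc f A * cfc g B).trace.re = ∑ i, ∑ j, f (hA.eigenvalues i) * g (hB.eigenvalues j) *
      Complex.normSq ((star (hA.eigenvectorUnitary : Mat d) * hB.eigenvectorUnitary) i j) := by
  rw [hA.cfc_eq, hB.cfc_eq, Matrix.IsHermitian.cfc, Matrix.IsHermitian.cfc,
    Unitary.conjStarAlgAut_apply, Unitary.conjStarAlgAut_apply]
  generalize (hA.eigenvectorUnitary : Mat d) = U
  generalize (hB.eigenvectorUnitary : Mat d) = V
  set a := Matrix.diagonal (RCLike.ofReal ∘ f ∘ hA.eigenvalues : Fin d → ℂ)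
  set b := Matrix.diagonal (RCLike.ofReal ∘ g ∘ hB.eigenvalues : Fin d → ℂ)
  have h : (U * a * star U * (V * b * star V)).trace
      = ((a * (star U * V)) * (b * star (star U * V))).trace := by
    rw [star_mul, star_star, Matrix.mul_assoc, Matrix.mul_assoc U, Matrix.trace_mul_comm U]
    simp only [Matrix.mul_assoc]
  rw [h]
  simp only [Matrix.trace, Matrix.diag_apply, Complex.re_sum]
  refine Finset.sum_congr rfl fun i _ => ?_
  rw [Matrix.mul_apply, Complex.re_sum]
  refine Finset.sum_congr rfl fun j _ => ?_
  rw [Matrix.diagonal_mul, Matrix.diagonal_mul, Matrix.star_apply, Complex.normSq_apply]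
  simp
  ring

/-- Adding Tr B − Tr A = 0 makes every summand of the double eigenvalue sum a multiple of a log a −
a log b − a + b, which is nonnegative because log x ≤ x − 1. -/
theorem relEntropy_nonneg {A B : Mat d} (hA : IsState A) (hB : B.PosDef)
    (hB1 : B.trace = 1) : 0 ≤ relEntropy A B := by
  have hAs : IsSelfAdjoint A := hA.1.isHermitian
  have hBs : IsSelfAdjoint B := hB.isHermitian
  have hc : ∀ f : ℝ → ℝ, ContinuousOn f (spectrum ℝ A) :=
    fun f => Matrix.finite_real_spectrum.continuousOn f
  have e1 : (A * matLog A).trace.re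
      = (cfc (fun x : ℝ => x * Real.log x) A * cfc (fun _ : ℝ => (1 : ℝ)) B).trace.re := by
    rw [cfc_const_one ℝ B, mul_one, cfc_mul (fun x : ℝ => x) Real.log A (hc _) (hc _), cfc_id' ℝ A]
    rfl
  have e2 : (A * matLog B).trace.re
      = (cfc (fun x : ℝ => x) A * cfc Real.log B).trace.re := by
    rw [cfc_id' ℝ A]
    rfl
  have e3 : A.trace.re = (cfc (fun x : ℝ => x) A * cfc (fun _ : ℝ => (1 : ℝ)) B).trace.re := by
    rw [cfc_id' ℝ A, cfc_const_one ℝ B, mul_one]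
  have e4 : B.trace.re = (cfc (fun _ : ℝ => (1 : ℝ)) A * cfc (fun x : ℝ => x) B).trace.re := by
    rw [cfc_id' ℝ B, cfc_const_one ℝ A, one_mul]
  have e : relEntropy A B = (A * matLog A).trace.re - (A * matLog B).trace.re
      - A.trace.re + B.trace.re := by
    rw [relEntropy, mul_sub, Matrix.trace_sub, hA.2, hB1]
    simp
  rw [e, e1, e2, e3, e4, trace_cfc_mul_cfc hAs hBs, trace_cfc_mul_cfc hAs hBs,
    trace_cfc_mul_cfc hAs hBs, trace_cfc_mul_cfc hAs hBs]
  simp only [← Finset.sum_sub_distrib, ← Finset.sum_add_distrib]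
  refine Finset.sum_nonneg fun i _ => Finset.sum_nonneg fun j _ => ?_
  have ha := hA.1.eigenvalues_nonneg i
  have hb : 0 < hB.isHermitian.eigenvalues j := hB.eigenvalues_pos j
  rw [← sub_mul, ← sub_mul, ← add_mul]
  refine mul_nonneg ?_ (Complex.normSq_nonneg _)
  change 0 ≤ hA.1.isHermitian.eigenvalues i * Real.log (hA.1.isHermitian.eigenvalues i) * 1
    - hA.1.isHermitian.eigenvalues i * Real.log (hB.isHermitian.eigenvalues j)
    - hA.1.isHermitian.eigenvalues i * 1 + 1 * hB.isHermitian.eigenvalues j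
  generalize hA.1.isHermitian.eigenvalues i = a at *
  generalize hB.isHermitian.eigenvalues j = b at *
  -- A may be singular; at a = 0 the convention log 0 = 0 leaves just b.
  rcases ha.eq_or_lt with rfl | ha
  · simpa using hb.le
  · have h := Real.log_le_sub_one_of_pos (div_pos hb ha)
    rw [Real.log_div hb.ne' ha.ne'] at h
    have h2 := mul_le_mul_of_nonneg_left h ha.le
    have h3 : a * (b / a - 1) = b - a := by field_simp
    rw [h3] at h2
    linarith

end Trace

/-! ### Derivatives along the model, in particular of relative entropy. -/

section Derivative

variable {d : ℕ}

/-- The real pairing `X ↦ Re Tr XY` as a real-linear functional. -/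
def traceMulRe (Y : Mat d) : Mat d →ₗ[ℝ] ℝ where
  toFun X := (X * Y).trace.re
  map_add' := by intro X X'; simp [Matrix.add_mul]
  map_smul' := by intro r X; simp

theorem traceMulRe_apply (X Y : Mat d) : traceMulRe Y X = (X * Y).trace.re := rfl

theorem tendsto_slope_of_entries {B : ℝ → Mat d} {B' : Mat d}
    (hB : ∀ a b, HasDerivAt (fun s => B s a b) (B' a b) 0) :
    Tendsto (fun s : ℝ => s⁻¹ • (B s - B 0)) (𝓝[≠] 0) (𝓝 B') := by
  refine tendsto_pi_nhds.2 fun a => tendsto_pi_nhds.2 fun b => ?_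
  have := hasDerivAt_iff_tendsto_slope.1 (hB a b)
  refine this.congr fun s => ?_
  simp [slope_def_module]

theorem tendsto_of_entries {B : ℝ → Mat d} {B' : Mat d}
    (hB : ∀ a b, HasDerivAt (fun s => B s a b) (B' a b) 0) :
    Tendsto B (𝓝 0) (𝓝 (B 0)) :=
  tendsto_pi_nhds.2 fun a => tendsto_pi_nhds.2 fun b => (hB a b).continuousAt

theorem hasDerivAt_linearMap_comp {B : ℝ → Mat d} {B' : Mat d}
    (hB : ∀ a b, HasDerivAt (fun s => B s a b) (B' a b) 0) (l : Mat d →ₗ[ℝ] ℝ) :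
    HasDerivAt (fun s => l (B s)) (l B') 0 := by
  rw [hasDerivAt_iff_tendsto_slope]
  have hc : Continuous l := l.continuous_of_finiteDimensional
  refine ((hc.tendsto _).comp (tendsto_slope_of_entries hB)).congr fun s => ?_
  simp [slope_def_module]

/-- D(B_s‖σ) = D(B_s‖B_0) + Tr B_s(log B_0 − log σ). The second term is linear in B_s, and the first
has zero derivative at s = 0. -/
theorem hasDerivAt_relEntropy {B : ℝ → Mat d} {B' : Mat d}
    (hB : ∀ a b, HasDerivAt (fun s => B s a b) (B' a b) 0)
    (hs : ∀ᶠ s in 𝓝 0, IsState (B s)) (h0 : (B 0).PosDef) (σ : Mat d) :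
    HasDerivAt (fun s => relEntropy (B s) σ)
      (B' * (matLog (B 0) - matLog σ)).trace.re 0 := by
  have hB1 : (B 0).trace = 1 := hs.self_of_nhds.2
  have hH : ∀ᶠ s in 𝓝 0, (B s).IsHermitian := hs.mono fun s h => h.1.isHermitian
  have hlim := tendsto_of_entries hB
  -- By nonnegativity of both orders, D(B_s‖B_0) is at most the symmetrized entropy Tr (B_s −
  -- B_0)(log B_s − log B_0). Divided by s, this tends to Tr B'·0 by continuity of the logarithm.
  have hrem : HasDerivAt (fun s => relEntropy (B s) (B 0)) 0 0 := by
    rw [hasDerivAt_iff_tendsto_slope]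
    have hm : Tendsto (fun s => ((s⁻¹ • (B s - B 0)) * (matLog (B s) - matLog (B 0))).trace.re)
        (𝓝[≠] 0) (𝓝 0) := by
      have hl : Tendsto (fun s => matLog (B s) - matLog (B 0)) (𝓝[≠] 0)
          (𝓝 (matLog (B 0) - matLog (B 0))) :=
        ((tendsto_matLog h0 hlim hH).mono_left nhdsWithin_le_nhds).sub_const _
      have hc : Continuous fun p : Mat d × Mat d => (p.1 * p.2).trace.re :=
        Complex.continuous_re.comp
          ((continuous_fst.matrix_mul continuous_snd).matrix_trace)
      have := (hc.tendsto _).comp ((tendsto_slope_of_entries hB).prodMk_nhds hl)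
      rwa [sub_self, mul_zero, Matrix.trace_zero, Complex.zero_re] at this
    have hm' := hm.norm
    rw [norm_zero] at hm'
    refine squeeze_zero_norm' ?_ hm'
    have hev : ∀ᶠ s in 𝓝 (0 : ℝ), IsState (B s) ∧ (B s).PosDef :=
      hs.and (eventually_posDef h0 hlim hH)
    filter_upwards [hev.filter_mono nhdsWithin_le_nhds] with s h
    have h00 : relEntropy (B 0) (B 0) = 0 := by simp [relEntropy]
    have h1 := relEntropy_nonneg h.1 h0 hB1
    have h2 := relEntropy_nonneg ⟨h0.posSemidef, hB1⟩ h.2 h.1.2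
    have hsum : relEntropy (B s) (B 0) + relEntropy (B 0) (B s)
        = ((B s - B 0) * (matLog (B s) - matLog (B 0))).trace.re := by
      simp only [relEntropy, sub_mul, mul_sub, Matrix.trace_sub, Complex.sub_re]
      ring
    rw [slope_def_module, h00, sub_zero, sub_zero, smul_eq_mul, norm_mul, smul_mul_assoc,
      Matrix.trace_smul, Complex.smul_re, smul_eq_mul, norm_mul, ← hsum]
    refine mul_le_mul_of_nonneg_left ?_ (norm_nonneg _)
    rw [Real.norm_of_nonneg h1, Real.norm_of_nonneg (add_nonneg h1 h2)]
    linarith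
  have hlin := hasDerivAt_linearMap_comp hB (traceMulRe (matLog (B 0) - matLog σ))
  have := hrem.add hlin
  rw [zero_add] at this
  refine this.congr_of_eventuallyEq (Eventually.of_forall fun s => ?_)
  simp only [traceMulRe_apply, relEntropy, mul_sub, Matrix.trace_sub, Complex.sub_re,
    Pi.add_apply]
  ring

theorem IsFullModel.hasDerivAt_entry {ρ : Param d → Mat d} {θ₀ : Param d} {ρs : Mat d}
    (h : IsFullModel ρ θ₀ ρs) (j : Fin (d ^ 2 - 1)) (a b : Fin d) :
    HasDerivAt (fun s : ℝ => ρ (θ₀ + s • coordVec j) a b) (partialMat ρ θ₀ j a b) 0 :=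
  (h.differentiable a b).lineDifferentiableAt.hasLineDerivAt

theorem tendsto_add_smul_nhds (θ₀ v : Param d) :
    Tendsto (fun s : ℝ => θ₀ + s • v) (𝓝 0) (𝓝 θ₀) := by
  have : Continuous fun s : ℝ => θ₀ + s • v := by fun_prop
  simpa using this.tendsto 0

theorem IsFullModel.hasLineDerivAt_linearMap {ρ : Param d → Mat d} {θ₀ : Param d} {ρs : Mat d}
    (h : IsFullModel ρ θ₀ ρs) (l : Mat d →ₗ[ℝ] ℝ) (j : Fin (d ^ 2 - 1)) :
    HasLineDerivAt ℝ (fun θ => l (ρ θ)) (l (partialMat ρ θ₀ j)) θ₀ (coordVec j) :=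
  hasDerivAt_linearMap_comp (B := fun s => ρ (θ₀ + s • coordVec j)) (h.hasDerivAt_entry j) l

theorem IsFullModel.hasLineDerivAt_relEntropy {ρ : Param d → Mat d} {θ₀ : Param d}
    {ρs : Mat d} (h : IsFullModel ρ θ₀ ρs) (hρ : ρs.PosDef) (σ : Mat d)
    (j : Fin (d ^ 2 - 1)) :
    HasLineDerivAt ℝ (fun θ => relEntropy (ρ θ) σ)
      (partialMat ρ θ₀ j * (matLog ρs - matLog σ)).trace.re θ₀ (coordVec j) := by
  have h0 : ρ (θ₀ + (0 : ℝ) • coordVec j) = ρs := by simp [h.base]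
  have := hasDerivAt_relEntropy (B := fun s => ρ (θ₀ + s • coordVec j)) (h.hasDerivAt_entry j)
    ((tendsto_add_smul_nhds θ₀ _).eventually h.isState) (h0 ▸ hρ) σ
  rw [h0] at this
  exact this

theorem IsFullModel.trace_partialMat {ρ : Param d → Mat d} {θ₀ : Param d} {ρs : Mat d}
    (h : IsFullModel ρ θ₀ ρs) (j : Fin (d ^ 2 - 1)) : (partialMat ρ θ₀ j).trace = 0 := by
  have hc : Continuous (Matrix.trace : Mat d → ℂ) := continuous_id.matrix_trace
  have h1 := (hc.tendsto _).comp (tendsto_slope_of_entries (h.hasDerivAt_entry j))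
  refine tendsto_nhds_unique (h1.congr' ?_) tendsto_const_nhds
  have hs := ((tendsto_add_smul_nhds θ₀ (coordVec j)).eventually h.isState).filter_mono
    (nhdsWithin_le_nhds (s := {0}ᶜ))
  filter_upwards [hs] with s hs
  simp [hs.2, h.isState.self_of_nhds.2]

theorem IsFullModel.isHermitian_partialMat {ρ : Param d → Mat d} {θ₀ : Param d} {ρs : Mat d}
    (h : IsFullModel ρ θ₀ ρs) (j : Fin (d ^ 2 - 1)) : (partialMat ρ θ₀ j).IsHermitian := by
  have hc : Continuous (fun M : Mat d => M.conjTranspose - M) :=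
    continuous_id.matrix_conjTranspose.sub continuous_id
  have h1 := (hc.tendsto _).comp (tendsto_slope_of_entries (h.hasDerivAt_entry j))
  refine sub_eq_zero.1 (tendsto_nhds_unique (h1.congr' ?_) tendsto_const_nhds)
  have hs := ((tendsto_add_smul_nhds θ₀ (coordVec j)).eventually h.isState).filter_mono
    (nhdsWithin_le_nhds (s := {0}ᶜ))
  filter_upwards [hs] with s hs
  have e1 := hs.1.isHermitian.eq
  have e2 := h.isState.self_of_nhds.1.isHermitian.eq
  simp [Matrix.conjTranspose_smul, e1, e2]

end Derivative

/-! ### Linear extension of additive functionals on the positive cone. -/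

section Extension

open scoped Matrix.Norms.L2Operator

variable {d : ℕ}

/-- A Hermitian H is the difference of the positive semidefinite matrices H + ‖H‖ and ‖H‖, which
dictates the extension F; precomposing with the self-adjoint part defines it on all matrices. -/
theorem exists_linearMap_of_posSemidef (m : Mat d → ℝ)
    (hadd : ∀ A B : Mat d, A.PosSemidef → B.PosSemidef → m (A + B) = m A + m B)
    (hsmul : ∀ (c : ℝ) (A : Mat d), 0 ≤ c → A.PosSemidef → m ((c : ℂ) • A) = c * m A) :
    ∃ l : Mat d →ₗ[ℝ] ℝ, ∀ A : Mat d, A.PosSemidef → l A = m A := by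
  let F : Mat d → ℝ := fun H => m (H + ((‖H‖ : ℝ) : ℂ) • (1 : Mat d)) - ‖H‖ * m 1
  have h1 : ∀ c : ℝ, 0 ≤ c → m ((c : ℂ) • (1 : Mat d)) = c * m 1 := fun c hc =>
    hsmul c 1 hc Matrix.PosSemidef.one
  -- Any admissible shift c computes the same F(H), so sums and multiples can use shifts other than
  -- their own norm.
  have key : ∀ (H : Mat d) (c : ℝ), H.IsHermitian → 0 ≤ c →
      (H + (c : ℂ) • (1 : Mat d)).PosSemidef → F H = m (H + (c : ℂ) • (1 : Mat d)) - c * m 1 := by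
    intro H c hH hc hp
    have e1 := hadd _ _ hp (posSemidef_smul_one (norm_nonneg H))
    have e2 := hadd _ _ (posSemidef_add_norm_smul_one hH) (posSemidef_smul_one hc)
    rw [h1 _ (norm_nonneg H)] at e1
    rw [h1 _ hc] at e2
    rw [add_right_comm] at e1
    simp only [F]
    linarith
  have hF0 : F 0 = 0 := by
    have := key 0 0 Matrix.isHermitian_zero le_rfl (by simpa using Matrix.PosSemidef.zero)
    rw [this]
    have := hsmul 0 0 le_rfl Matrix.PosSemidef.zero
    simpa using this
  have hFadd : ∀ H K : Mat d, H.IsHermitian → K.IsHermitian → F (H + K) = F H + F K := by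
    intro H K hH hK
    have pH := posSemidef_add_norm_smul_one hH
    have pK := posSemidef_add_norm_smul_one hK
    have e : H + K + ((‖H‖ + ‖K‖ : ℝ) : ℂ) • (1 : Mat d)
        = (H + ((‖H‖ : ℝ) : ℂ) • (1 : Mat d)) + (K + ((‖K‖ : ℝ) : ℂ) • (1 : Mat d)) := by
      push_cast
      module
    have hp := pH.add pK
    rw [← e] at hp
    rw [key (H + K) (‖H‖ + ‖K‖) (hH.add hK) (by positivity) hp, e, hadd _ _ pH pK]
    simp only [F]
    ring
  have hFneg : ∀ H : Mat d, H.IsHermitian → F (-H) = -F H := by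
    intro H hH
    have := hFadd H (-H) hH hH.neg
    rw [add_neg_cancel, hF0] at this
    linarith
  have hFpos : ∀ (c : ℝ) (H : Mat d), 0 ≤ c → H.IsHermitian → F (c • H) = c * F H := by
    intro c H hc hH
    have pH := posSemidef_add_norm_smul_one hH
    have e : c • H + ((c * ‖H‖ : ℝ) : ℂ) • (1 : Mat d)
        = (c : ℂ) • (H + ((‖H‖ : ℝ) : ℂ) • (1 : Mat d)) := by
      rw [← Complex.coe_smul]
      push_cast
      module
    have hp : (c • H + ((c * ‖H‖ : ℝ) : ℂ) • (1 : Mat d)).PosSemidef := by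
      rw [e]
      exact pH.smul (by exact_mod_cast hc)
    rw [key (c • H) (c * ‖H‖) ?_ (by positivity) hp, e, hsmul _ _ hc pH]
    · simp only [F]
      ring
    · exact IsSelfAdjoint.smul (.all c) hH
  let G : selfAdjoint (Mat d) →ₗ[ℝ] ℝ :=
    { toFun := fun H => F H
      map_add' := fun H K => hFadd H K H.2 K.2
      map_smul' := fun c H => by
        rw [selfAdjoint.val_smul, smul_eq_mul, RingHom.id_apply]
        rcases le_total 0 c with hc | hc
        · exact hFpos c H hc H.2
        · have := hFpos (-c) (-H) (neg_nonneg.2 hc) (Matrix.IsHermitian.neg H.2)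
          rw [neg_smul_neg, hFneg _ H.2] at this
          rw [this]
          ring }
  refine ⟨G ∘ₗ selfAdjointPart ℝ, fun A hA => ?_⟩
  have hA' : IsSelfAdjoint A := hA.isHermitian
  have : (selfAdjointPart ℝ A : Mat d) = A := hA'.coe_selfAdjointPart_apply ℝ
  change F (selfAdjointPart ℝ A : Mat d) = m A
  rw [this]
  have hk := key A 0 hA.isHermitian le_rfl (by simpa using hA)
  simpa using hk

end Extension

/-! ### Dependence of outcome laws and means on the state. -/

section Outcome

variable {d : ℕ} {Ω : Type} [MeasurableSpace Ω] (E : POVM d Ω)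

theorem POVM.outcome_apply {ρ : Mat d} (hρ : ρ.PosSemidef) {A : Set Ω}
    (hA : MeasurableSet A) :
    E.outcome ρ A = ENNReal.ofReal (ρ * E.effect A).trace.re := by
  rw [POVM.outcome, dif_pos hρ, Measure.ofMeasurable_apply _ hA]

theorem POVM.outcome_add {ρ τ : Mat d} (hρ : ρ.PosSemidef) (hτ : τ.PosSemidef) :
    E.outcome (ρ + τ) = E.outcome ρ + E.outcome τ := by
  ext A hA
  rw [Measure.add_apply, E.outcome_apply (hρ.add hτ) hA, E.outcome_apply hρ hA,
    E.outcome_apply hτ hA, ← ENNReal.ofReal_add (trace_mul_re_nonneg hρ (E.posSemidef A hA))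
    (trace_mul_re_nonneg hτ (E.posSemidef A hA))]
  simp [add_mul]

theorem POVM.outcome_smul {ρ : Mat d} {c : ℝ} (hc : 0 ≤ c) (hρ : ρ.PosSemidef) :
    E.outcome ((c : ℂ) • ρ) = ENNReal.ofReal c • E.outcome ρ := by
  ext A hA
  rw [Measure.smul_apply, E.outcome_apply (hρ.smul (by exact_mod_cast hc)) hA,
    E.outcome_apply hρ hA, smul_eq_mul, ← ENNReal.ofReal_mul hc]
  simp

instance POVM.isFiniteMeasure_outcome (ρ : Mat d) : IsFiniteMeasure (E.outcome ρ) := by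
  by_cases hρ : ρ.PosSemidef
  · exact ⟨by rw [E.outcome_apply hρ MeasurableSet.univ]; exact ENNReal.ofReal_lt_top⟩
  · rw [POVM.outcome, dif_neg hρ]
    infer_instance

theorem POVM.outcome_real_apply {ρ : Mat d} (hρ : ρ.PosSemidef) {A : Set Ω}
    (hA : MeasurableSet A) : (E.outcome ρ).real A = (ρ * E.effect A).trace.re := by
  rw [measureReal_def, E.outcome_apply hρ hA,
    ENNReal.toReal_ofReal (trace_mul_re_nonneg hρ (E.posSemidef A hA))]

theorem POVM.exists_outcome_le {ρs : Mat d} (hρ : ρs.PosDef) {H : Mat d}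
    (hH : H.PosSemidef) : ∃ c : ℝ, E.outcome H ≤ ENNReal.ofReal c • E.outcome ρs := by
  obtain ⟨c, hc, hp⟩ := exists_posSemidef_smul_sub hρ hH.isHermitian
  refine ⟨c, ?_⟩
  have := E.outcome_add hH hp
  rw [add_sub_cancel, E.outcome_smul hc hρ.posSemidef] at this
  rw [this]
  exact Measure.le_add_right le_rfl

theorem POVM.outcome_absolutelyContinuous {ρs : Mat d} (hρ : ρs.PosDef) {H : Mat d}
    (hH : H.PosSemidef) : E.outcome H ≪ E.outcome ρs := by
  obtain ⟨c, hc⟩ := E.exists_outcome_le hρ hH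
  exact (Measure.absolutelyContinuous_of_le hc).trans (Measure.smul_absolutelyContinuous)

theorem POVM.integrable_outcome {ρs : Mat d} (hρ : ρs.PosDef) {est : Ω → ℝ}
    (hi : Integrable est (E.outcome ρs)) {H : Mat d} (hH : H.PosSemidef) :
    Integrable est (E.outcome H) := by
  obtain ⟨c, hc⟩ := E.exists_outcome_le hρ hH
  exact (hi.smul_measure ENNReal.ofReal_ne_top).mono_measure hc

/-- Integrability at the faithful state passes to every positive semidefinite H, since the law at H
is bounded by a multiple of the law at ρ*. Additivity and homogeneity of the laws then carry over to
means. -/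
theorem POVM.exists_linearMap_mean {ρs : Mat d} (hρ : ρs.PosDef) {est : Ω → ℝ}
    (hi : Integrable est (E.outcome ρs)) :
    ∃ l : Mat d →ₗ[ℝ] ℝ, ∀ H : Mat d, H.PosSemidef → l H = mean E est H := by
  refine exists_linearMap_of_posSemidef (mean E est) (fun A B hA hB => ?_) fun c A hc hA => ?_
  · rw [mean, E.outcome_add hA hB, integral_add_measure (E.integrable_outcome hρ hi hA)
      (E.integrable_outcome hρ hi hB)]
    rfl
  · rw [mean, E.outcome_smul hc hA, integral_smul_measure, ENNReal.toReal_ofReal hc]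
    rfl

end Outcome

/-! ### The quantum Cramér–Rao inequality for a general POVM. -/

section LowerBound

/-- The setwise inequalities say that for each constant r the densities satisfy 2rq ≤ r² + 2rc + n
almost everywhere with respect to P. Substituting r = t(ω) and integrating gives the conclusion. -/
theorem two_mul_integral_le_of_forall_measureReal_le {Ω : Type*} [MeasurableSpace Ω]
    {P Q N : Measure Ω} [IsFiniteMeasure P] [IsFiniteMeasure Q] [IsFiniteMeasure N]
    (hQ : Q ≪ P) (hN : N ≪ P) {c : ℝ} {t : Ω → ℝ}
    (htP : Integrable t P) (htQ : Integrable t Q) (ht2 : Integrable (fun ω => t ω ^ 2) P)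
    (h : ∀ (r : ℝ) (s : Set Ω), MeasurableSet s →
      2 * r * Q.real s ≤ (r ^ 2 + 2 * r * c) * P.real s + N.real s) :
    2 * ∫ ω, t ω ∂Q ≤ ∫ ω, t ω ^ 2 ∂P + 2 * c * ∫ ω, t ω ∂P + N.real Set.univ := by
  set q : Ω → ℝ := fun ω => (Q.rnDeriv P ω).toReal
  set n : Ω → ℝ := fun ω => (N.rnDeriv P ω).toReal
  have hq : Integrable q P := Measure.integrable_toReal_rnDeriv
  have hn : Integrable n P := Measure.integrable_toReal_rnDeriv
  have hr : ∀ r : ℝ, ∀ᵐ ω ∂P, 2 * r * q ω ≤ (r ^ 2 + 2 * r * c) + n ω := by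
    intro r
    refine ae_le_of_forall_setIntegral_le (hq.const_mul _) ((integrable_const _).add hn)
      fun s hs _ => ?_
    have e := h r s hs
    rw [integral_const_mul, Measure.setIntegral_toReal_rnDeriv hQ,
      integral_add (integrable_const _) hn.integrableOn, Measure.setIntegral_toReal_rnDeriv hN]
    simpa [mul_comm] using e
  -- The exceptional null set depends on r: rational r gives one common null set, and continuity in
  -- r reaches the real number t(ω).
  have hall : ∀ᵐ ω ∂P, 2 * t ω * q ω ≤ (t ω ^ 2 + 2 * t ω * c) + n ω := by
    have hae : ∀ᵐ ω ∂P, ∀ r : ℚ, 2 * (r : ℝ) * q ω ≤ ((r : ℝ) ^ 2 + 2 * r * c) + n ω :=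
      ae_all_iff.2 fun r => hr r
    filter_upwards [hae] with ω hω
    have hcl : IsClosed {r : ℝ | 2 * r * q ω ≤ (r ^ 2 + 2 * r * c) + n ω} :=
      isClosed_le (by fun_prop) (by fun_prop)
    have hd : Dense {r : ℝ | 2 * r * q ω ≤ (r ^ 2 + 2 * r * c) + n ω} :=
      Rat.denseRange_cast.mono (by rintro _ ⟨r, rfl⟩; exact hω r)
    have : t ω ∈ closure {r : ℝ | 2 * r * q ω ≤ (r ^ 2 + 2 * r * c) + n ω} := hd _
    rwa [hcl.closure_eq] at this
  have htq : Integrable (fun ω => q ω * t ω) P := (integrable_toReal_rnDeriv_mul_iff hQ).2 htQ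
  have hf : Integrable (fun ω => t ω ^ 2 + 2 * c * t ω) P := ht2.add (htP.const_mul (2 * c))
  have hle := integral_mono_ae (f := fun ω => 2 * (q ω * t ω))
    (g := fun ω => (t ω ^ 2 + 2 * c * t ω) + n ω) (htq.const_mul 2)
    (hf.add hn) (by
      filter_upwards [hall] with ω hω
      linarith)
  rw [integral_const_mul, integral_toReal_rnDeriv_mul hQ] at hle
  refine hle.trans_eq ?_
  rw [integral_add hf hn, integral_add ht2 (htP.const_mul (2 * c)),
    integral_const_mul, Measure.integral_toReal_rnDeriv hN]

variable {d : ℕ} {Ω : Type} [MeasurableSpace Ω]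

/-- With t = est − g, positivity of (r − X)ρ*(r − X), tested on effects and integrated with r =
t(ω), gives 2 Tr (ρ* ∘ X)X ≤ ∫ t² + Tr Xρ*X. Both traces equal Tr ρ*X², so the bound follows. -/
theorem POVM.ofReal_trace_mul_sq_le_lintegral (E : POVM d Ω) {est : Ω → ℝ}
    (hm : Measurable est) {ρs X : Mat d} {g : ℝ} (hρ : ρs.PosDef)
    (hX : X.IsHermitian) (hX0 : (ρs * X).trace.re = 0) (hi : Integrable est (E.outcome ρs))
    (hmean : ∀ H : Mat d, H.PosSemidef →
      mean E est H = (H * (X + (g : ℂ) • (1 : Mat d))).trace.re) :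
    ENNReal.ofReal (ρs * X ^ 2).trace.re ≤
      ∫⁻ ω, ENNReal.ofReal ((est ω - g) ^ 2) ∂(E.outcome ρs) := by
  by_cases hfin : ∫⁻ ω, ENNReal.ofReal ((est ω - g) ^ 2) ∂(E.outcome ρs) = ∞
  · rw [hfin]
    exact le_top
  have ht2 : Integrable (fun ω => (est ω - g) ^ 2) (E.outcome ρs) := by
    refine ⟨((hm.sub_const g).pow_const 2).aestronglyMeasurable, ?_⟩
    rw [hasFiniteIntegral_iff_ofReal (Eventually.of_forall fun ω => sq_nonneg _)]
    exact lt_top_iff_ne_top.2 hfin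
  rw [← ofReal_integral_eq_lintegral_ofReal ht2 (Eventually.of_forall fun ω => sq_nonneg _)]
  refine ENNReal.ofReal_le_ofReal ?_
  -- ρ* ∘ X need not be positive semidefinite and so has no outcome measure of its own. It is
  -- replaced by cρ* + ρ* ∘ X; the extra terms vanish at the end because Tr ρ*X = 0.
  have hK : (-(jordan ρs X)).IsHermitian := by
    have h1 := hρ.isHermitian.eq
    have h2 := hX.eq
    simp [Matrix.IsHermitian, jordan, Matrix.conjTranspose_smul, h1, h2, add_comm]
  obtain ⟨c, hc, hp⟩ := exists_posSemidef_smul_sub hρ hK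
  rw [sub_neg_eq_add] at hp
  have hN : (X * ρs * X).PosSemidef := by
    have := hρ.posSemidef.mul_mul_conjTranspose_same X
    rwa [hX.eq] at this
  have hmean' : ∀ H : Mat d, H.PosSemidef →
      ∫ ω, (est ω - g) ∂(E.outcome H) = (H * X).trace.re := by
    intro H hH
    have hu : (E.outcome H).real Set.univ = H.trace.re := by
      rw [E.outcome_real_apply hH MeasurableSet.univ, E.univ, mul_one]
    rw [integral_sub (E.integrable_outcome hρ hi hH) (integrable_const g), integral_const, hu,
      smul_eq_mul]
    have := hmean H hH
    rw [mean] at this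
    rw [this]
    simp [mul_add, mul_comm]
  have hint : ∀ H : Mat d, H.PosSemidef → Integrable (fun ω => est ω - g) (E.outcome H) :=
    fun H hH => (E.integrable_outcome hρ hi hH).sub (integrable_const g)
  have hcyc : (X * ρs * X).trace = (ρs * X ^ 2).trace := by
    rw [mul_assoc, Matrix.trace_mul_comm, pow_two, mul_assoc]
  have hQX : (((c : ℂ) • ρs + jordan ρs X) * X).trace.re = (ρs * X ^ 2).trace.re := by
    have e : (X * (ρs * X)).trace = (ρs * X ^ 2).trace := by rw [← hcyc, mul_assoc]
    rw [pow_two] at e ⊢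
    simp [jordan, add_mul, hX0, mul_assoc, e]
    ring
  have main := two_mul_integral_le_of_forall_measureReal_le
    (E.outcome_absolutelyContinuous hρ hp) (E.outcome_absolutelyContinuous hρ hN) (c := c)
    (hint _ hρ.posSemidef) (hint _ hp) ht2 (by
      intro r s hs
      rw [E.outcome_real_apply hp hs, E.outcome_real_apply hρ.posSemidef hs,
        E.outcome_real_apply hN hs]
      have hr : (((r : ℂ) • (1 : Mat d) - X) * ρs * ((r : ℂ) • (1 : Mat d) - X)).PosSemidef := by
        have := hρ.posSemidef.mul_mul_conjTranspose_same ((r : ℂ) • (1 : Mat d) - X)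
        rwa [Matrix.conjTranspose_sub, hX.eq, Matrix.conjTranspose_smul,
          Matrix.conjTranspose_one, Complex.star_def, Complex.conj_ofReal] at this
      have h0 := trace_mul_re_nonneg hr (E.posSemidef s hs)
      have e : ((r : ℂ) • (1 : Mat d) - X) * ρs * ((r : ℂ) • (1 : Mat d) - X)
          = ((r ^ 2 + 2 * r * c : ℝ) : ℂ) • ρs + X * ρs * X
            - ((2 * r : ℝ) : ℂ) • ((c : ℂ) • ρs + jordan ρs X) := by
        simp only [jordan, sub_mul, mul_sub, smul_mul_assoc, mul_smul_comm, one_mul, mul_one]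
        push_cast
        module
      rw [e, sub_mul, add_mul, smul_mul_assoc, smul_mul_assoc, Matrix.trace_sub,
        Matrix.trace_add, Matrix.trace_smul, Matrix.trace_smul, Complex.sub_re, Complex.add_re,
        smul_eq_mul, smul_eq_mul, Complex.re_ofReal_mul, Complex.re_ofReal_mul] at h0
      linarith)
  rw [hmean' _ hp, hmean' _ hρ.posSemidef, hX0, hQX,
    E.outcome_real_apply hN MeasurableSet.univ, E.univ, mul_one, hcyc] at main
  linarith

end LowerBound

/-! ### Attainment by the spectral measurement. -/

section SpectralMeasurement

variable {d : ℕ} {X : Mat d}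

/-- The projective measurement of a Hermitian matrix, with outcomes labelling its eigenvalues. -/
def spectralPOVM (hX : X.IsHermitian) : POVM d (Fin d) where
  effect A := (hX.eigenvectorUnitary : Mat d) * Matrix.diagonal (A.indicator 1) *
    star (hX.eigenvectorUnitary : Mat d)
  posSemidef A _ := by
    refine Matrix.PosSemidef.mul_mul_conjTranspose_same ?_ _
    refine Matrix.PosSemidef.diagonal fun i => ?_
    by_cases hi : i ∈ A <;> simp [hi]
  univ := by
    rw [Set.indicator_univ, Matrix.diagonal_one', mul_one]
    exact Unitary.coe_mul_star_self _
  hasSum_iUnion A _ hd := by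
    have hdiag : HasSum (fun n => (A n).indicator (1 : Fin d → ℂ))
        ((⋃ n, A n).indicator 1) := by
      refine Pi.hasSum.2 fun i => ?_
      by_cases hi : i ∈ ⋃ n, A n
      · obtain ⟨n, hn⟩ := Set.mem_iUnion.1 hi
        have h := hasSum_single (f := fun m => (A m).indicator (1 : Fin d → ℂ) i) n fun m hm =>
          Set.indicator_of_notMem (fun hmi => Set.disjoint_left.1 (hd hm) hmi hn) _
        simpa [hi, hn] using h
      · have : ∀ n, i ∉ A n := fun n hn => hi (Set.mem_iUnion.2 ⟨n, hn⟩)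
        simp [hi, this, hasSum_zero]
    have h := hdiag.matrix_diagonal
    exact (h.mul_left (hX.eigenvectorUnitary : Mat d)).mul_right
      (star (hX.eigenvectorUnitary : Mat d))

theorem integral_outcome_spectralPOVM (hX : X.IsHermitian) {ρ : Mat d} (hρ : ρ.PosSemidef)
    (f : ℝ → ℝ) :
    ∫ i, f (hX.eigenvalues i) ∂((spectralPOVM hX).outcome ρ) = (ρ * cfc f X).trace.re := by
  rw [integral_fintype (Integrable.of_finite), hX.cfc_eq, Matrix.IsHermitian.cfc,
    Unitary.conjStarAlgAut_apply]
  have h : ∀ D : Mat d, (ρ * ((hX.eigenvectorUnitary : Mat d) * D *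
      star (hX.eigenvectorUnitary : Mat d))).trace
      = (D * (star (hX.eigenvectorUnitary : Mat d) * ρ * hX.eigenvectorUnitary)).trace := by
    intro D
    rw [mul_assoc (hX.eigenvectorUnitary : Mat d), ← mul_assoc ρ, Matrix.trace_mul_comm,
      mul_assoc, ← mul_assoc (star _)]
  refine Eq.trans ?_ (congrArg Complex.re (h _)).symm
  rw [Matrix.trace, Complex.re_sum]
  refine Finset.sum_congr rfl fun i _ => ?_
  rw [POVM.outcome_real_apply _ hρ (MeasurableSet.singleton i), Matrix.diag_apply,
    Matrix.diagonal_mul]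
  change (ρ * ((hX.eigenvectorUnitary : Mat d) * Matrix.diagonal (Set.indicator {i} 1) *
    star (hX.eigenvectorUnitary : Mat d))).trace.re • _ = _
  rw [h, Matrix.trace, Finset.sum_eq_single i]
  · simp [Matrix.diagonal_mul, mul_comm]
  · intro j _ hj
    simp [Matrix.diagonal_mul, hj]
  · simp

variable {ρ : Param d → Mat d} {θ₀ : Param d} {ρs : Mat d}

/-- Measuring X and adding g(θ₀) to the eigenvalue gives mean Tr τ(X + g(θ₀)) in the state τ, whose
derivatives are those of g because ∂_jρ is traceless. The squared deviation is the spectral value of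
X². -/
theorem IsFullModel.mem_achievableMSE (h : IsFullModel ρ θ₀ ρs) (hX : X.IsHermitian)
    (hX0 : (ρs * X).trace.re = 0) {g : Param d → ℝ}
    (hg : ∀ j, HasLineDerivAt ℝ g (partialMat ρ θ₀ j * X).trace.re θ₀ (coordVec j)) :
    ENNReal.ofReal (ρs * X ^ 2).trace.re ∈ achievableMSE ρ θ₀ g := by
  have hXs : IsSelfAdjoint X := hX
  have hs : IsState ρs := h.base ▸ h.isState.self_of_nhds
  have hmean : ∀ τ : Mat d, τ.PosSemidef →
      mean (spectralPOVM hX) (fun i => hX.eigenvalues i + g θ₀) τ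
        = traceMulRe (X + ((g θ₀ : ℝ) : ℂ) • (1 : Mat d)) τ := by
    intro τ hτ
    rw [mean, integral_outcome_spectralPOVM hX hτ (fun x => x + g θ₀), traceMulRe_apply,
      cfc_add_const (g θ₀) (fun x => x) X, cfc_id' ℝ X, Algebra.algebraMap_eq_smul_one,
      Complex.coe_smul]
  refine ⟨Fin d, inferInstance, spectralPOVM hX, fun i => hX.eigenvalues i + g θ₀,
    ⟨measurable_of_finite _, Eventually.of_forall fun _ => Integrable.of_finite, ?_, ?_⟩, ?_⟩
  · rw [h.base, hmean _ hs.1, traceMulRe_apply, mul_add, Matrix.trace_add, Complex.add_re, hX0]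
    simp [hs.2]
  · intro j
    refine ⟨_, ?_, hg j⟩
    have hl := h.hasLineDerivAt_linearMap (traceMulRe (X + ((g θ₀ : ℝ) : ℂ) • (1 : Mat d))) j
    have e : traceMulRe (X + ((g θ₀ : ℝ) : ℂ) • (1 : Mat d)) (partialMat ρ θ₀ j)
        = (partialMat ρ θ₀ j * X).trace.re := by
      simp [traceMulRe_apply, mul_add, h.trace_partialMat j]
    rw [e] at hl
    refine HasDerivAt.congr_of_eventuallyEq hl ?_
    filter_upwards [(tendsto_add_smul_nhds θ₀ (coordVec j)).eventually h.isState] with s hs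
    exact hmean _ hs.1
  · rw [mse, h.base, ← ofReal_integral_eq_lintegral_ofReal Integrable.of_finite
      (Eventually.of_forall fun i => sq_nonneg _)]
    simp only [add_sub_cancel_right]
    rw [integral_outcome_spectralPOVM hX hs.1 (fun x => x ^ 2), cfc_pow_id X 2]

end SpectralMeasurement

/-! ### The model's tangent space and base point span the Hermitian matrices. -/

section Dimension

variable {d : ℕ}

instance finite_selfAdjoint_mat : Module.Finite ℝ (selfAdjoint (Mat d)) :=
  inferInstanceAs (Module.Finite ℝ (selfAdjoint.submodule ℝ (Mat d)))

/-- Multiplication by i identifies the self-adjoint with the skew-adjoint part, so each has half of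
the real dimension 2d². -/
theorem finrank_selfAdjoint_mat : Module.finrank ℝ (selfAdjoint (Mat d)) = d ^ 2 := by
  let e : selfAdjoint (Mat d) ≃ₗ[ℝ] skewAdjoint (Mat d) :=
    { toFun := fun H => ⟨Complex.I • (H : Mat d), by
        rw [skewAdjoint.mem_iff, star_smul, H.2.star_eq]; simp⟩
      invFun := fun H => ⟨(-Complex.I) • (H : Mat d), by
        rw [selfAdjoint.mem_iff, star_smul, skewAdjoint.mem_iff.1 H.2]; simp⟩
      map_add' := fun H K => by ext1; simp
      map_smul' := fun c H => by
        ext1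
        simp [smul_comm Complex.I c]
      left_inv := fun H => by ext1; simp [smul_smul]
      right_inv := fun H => by ext1; simp [smul_smul] }
  have : Module.Finite ℝ (skewAdjoint (Mat d)) :=
    inferInstanceAs (Module.Finite ℝ (skewAdjoint.submodule ℝ (Mat d)))
  have h1 := (StarModule.decomposeProdAdjoint ℝ (Mat d)).finrank_eq
  rw [Module.finrank_prod, ← e.finrank_eq, finrank_real_of_complex, Module.finrank_matrix] at h1
  simp at h1
  rw [pow_two]
  omega

/-- The d² − 1 independent derivatives are traceless while ρ* has trace one, so together they form a
basis of the Hermitian matrices. Full parameterization enters the lower bound here. -/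
theorem IsFullModel.linearMap_eq_of_isHermitian {ρ : Param d → Mat d} {θ₀ : Param d}
    {ρs : Mat d} (h : IsFullModel ρ θ₀ ρs) {l₁ l₂ : Mat d →ₗ[ℝ] ℝ} (h0 : l₁ ρs = l₂ ρs)
    (hj : ∀ j, l₁ (partialMat ρ θ₀ j) = l₂ (partialMat ρ θ₀ j)) {H : Mat d}
    (hH : H.IsHermitian) : l₁ H = l₂ H := by
  have hs : IsState ρs := h.base ▸ h.isState.self_of_nhds
  -- Needed for the truncated subtraction: d² − 1 + 1 = d² fails at d = 0.
  have hd : d ≠ 0 := by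
    rintro rfl
    simpa using hs.2
  let ι : selfAdjoint (Mat d) →ₗ[ℝ] Mat d := (selfAdjoint.submodule ℝ (Mat d)).subtype
  let v : Option (Fin (d ^ 2 - 1)) → selfAdjoint (Mat d) := fun o =>
    o.elim ⟨ρs, hs.1.isHermitian⟩ fun j => ⟨partialMat ρ θ₀ j, h.isHermitian_partialMat j⟩
  have hv : LinearIndependent ℝ v := by
    refine linearIndependent_option.2 ⟨LinearIndependent.of_comp ι h.linearIndependent, ?_⟩
    intro hmem
    have hle : Submodule.span ℝ (Set.range (v ∘ some))
        ≤ LinearMap.ker (traceMulRe (1 : Mat d) ∘ₗ ι) := by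
      rw [Submodule.span_le]
      rintro _ ⟨j, rfl⟩
      change (partialMat ρ θ₀ j * 1).trace.re = 0
      rw [mul_one, h.trace_partialMat, Complex.zero_re]
    have h1 : (traceMulRe (1 : Mat d) ∘ₗ ι) (v none) = 0 := LinearMap.mem_ker.1 (hle hmem)
    have h2 : ι (v none) = ρs := rfl
    rw [LinearMap.comp_apply, h2, traceMulRe_apply, mul_one, hs.2] at h1
    exact one_ne_zero h1
  have hcard : Fintype.card (Option (Fin (d ^ 2 - 1)))
      = Module.finrank ℝ (selfAdjoint (Mat d)) := by
    rw [finrank_selfAdjoint_mat, Fintype.card_option, Fintype.card_fin]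
    exact Nat.sub_add_cancel (Nat.one_le_pow _ _ (Nat.pos_of_ne_zero hd))
  have hspan := hv.span_eq_top_of_card_eq_finrank' hcard
  have hext : l₁ ∘ₗ ι = l₂ ∘ₗ ι := by
    refine LinearMap.ext_on_range hspan fun o => ?_
    cases o with
    | none => exact h0
    | some j => exact hj j
  exact LinearMap.congr_fun hext ⟨H, hH⟩

end Dimension

/-! ### The Cramér–Rao type bound as Tr ρ*X². -/

section Bound

variable {d : ℕ} {ρ : Param d → Mat d} {θ₀ : Param d} {ρs X : Mat d}

/-- The estimator's mean and H ↦ Tr H(X + g(θ₀)) are linear functionals agreeing on ρ* and on each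
∂_jρ, hence on all Hermitian matrices; this is the input to the Cauchy–Schwarz bound. -/
theorem IsFullModel.le_of_mem_achievableMSE (h : IsFullModel ρ θ₀ ρs) (hρ : ρs.PosDef)
    (hX : X.IsHermitian) (hX0 : (ρs * X).trace.re = 0) {g : Param d → ℝ}
    (hg : ∀ j, HasLineDerivAt ℝ g (partialMat ρ θ₀ j * X).trace.re θ₀ (coordVec j))
    {v : ℝ≥0∞} (hv : v ∈ achievableMSE ρ θ₀ g) :
    ENNReal.ofReal (ρs * X ^ 2).trace.re ≤ v := by
  obtain ⟨Ω, _, E, est, hE, rfl⟩ := hv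
  have hs : IsState ρs := h.base ▸ h.isState.self_of_nhds
  have hi : Integrable est (E.outcome ρs) := h.base ▸ hE.integrable.self_of_nhds
  obtain ⟨l, hl⟩ := E.exists_linearMap_mean hρ hi
  rw [mse, h.base]
  refine E.ofReal_trace_mul_sq_le_lintegral hE.measurable hρ hX hX0 hi fun H hH => ?_
  rw [← hl H hH]
  refine h.linearMap_eq_of_isHermitian (l₂ := traceMulRe (X + ((g θ₀ : ℝ) : ℂ) • (1 : Mat d)))
    ?_ (fun j => ?_) hH.isHermitian
  · have := hE.value
    rw [h.base] at this
    rw [hl _ hs.1, this, traceMulRe_apply, mul_add, Matrix.trace_add, Complex.add_re, hX0]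
    simp [hs.2]
  · obtain ⟨c, hc, hc'⟩ := hE.deriv j
    have e : traceMulRe (X + ((g θ₀ : ℝ) : ℂ) • (1 : Mat d)) (partialMat ρ θ₀ j)
        = (partialMat ρ θ₀ j * X).trace.re := by
      simp [traceMulRe_apply, mul_add, h.trace_partialMat j]
    rw [e, ← hc'.unique (hg j)]
    refine HasDerivAt.unique (h.hasLineDerivAt_linearMap l j) ?_
    refine HasDerivAt.congr_of_eventuallyEq hc ?_
    filter_upwards [(tendsto_add_smul_nhds θ₀ (coordVec j)).eventually h.isState] with s hs
    exact hl _ hs.1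

theorem IsFullModel.crBound_eq (h : IsFullModel ρ θ₀ ρs) (hρ : ρs.PosDef)
    (hX : X.IsHermitian) (hX0 : (ρs * X).trace.re = 0) {g : Param d → ℝ}
    (hg : ∀ j, HasLineDerivAt ℝ g (partialMat ρ θ₀ j * X).trace.re θ₀ (coordVec j)) :
    crBound ρ θ₀ g = ENNReal.ofReal (ρs * X ^ 2).trace.re :=
  le_antisymm (sInf_le (h.mem_achievableMSE hX hX0 hg))
    (le_sInf fun _ hv => h.le_of_mem_achievableMSE hρ hX hX0 hg hv)

/-- The centred observable `log ρ - log σ - D(ρ‖σ)`. -/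
def centredLogRatio (ρs σ : Mat d) : Mat d :=
  matLog ρs - matLog σ - ((relEntropy ρs σ : ℝ) : ℂ) • (1 : Mat d)

theorem isHermitian_centredLogRatio (ρs σ : Mat d) : (centredLogRatio ρs σ).IsHermitian := by
  have h1 := (isHermitian_matLog ρs).eq
  have h2 := (isHermitian_matLog σ).eq
  simp [Matrix.IsHermitian, centredLogRatio, Matrix.conjTranspose_smul, h1, h2]

theorem trace_mul_centredLogRatio (hρ1 : ρs.trace = 1) (σ : Mat d) :
    (ρs * centredLogRatio ρs σ).trace.re = 0 := by
  rw [centredLogRatio, mul_sub, Matrix.trace_sub, Complex.sub_re, ← relEntropy]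
  simp [hρ1]

theorem IsFullModel.hasLineDerivAt_relEntropy_centred (h : IsFullModel ρ θ₀ ρs)
    (hρ : ρs.PosDef) (σ : Mat d) (j : Fin (d ^ 2 - 1)) :
    HasLineDerivAt ℝ (fun θ => relEntropy (ρ θ) σ)
      (partialMat ρ θ₀ j * centredLogRatio ρs σ).trace.re θ₀ (coordVec j) := by
  have e : (partialMat ρ θ₀ j * centredLogRatio ρs σ).trace.re
      = (partialMat ρ θ₀ j * (matLog ρs - matLog σ)).trace.re := by
    rw [centredLogRatio, mul_sub _ (matLog ρs - matLog σ), Matrix.trace_sub, Complex.sub_re]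
    simp [h.trace_partialMat j]
  rw [e]
  exact h.hasLineDerivAt_relEntropy hρ σ j

end Bound

/-! ### SLD geometry and the construction of an adapted orthogonal model. -/

section SymmetricLogarithmicDerivative

variable {d : ℕ}

theorem isHermitian_jordan {X Y : Mat d} (hX : X.IsHermitian) (hY : Y.IsHermitian) :
    (jordan X Y).IsHermitian := by
  simp [Matrix.IsHermitian, jordan, Matrix.conjTranspose_smul, hX.eq, hY.eq, add_comm]

theorem jordan_comm (X Y : Mat d) : jordan X Y = jordan Y X := by
  rw [jordan, jordan, add_comm]

theorem sldInner_comm (ρ X Y : Mat d) : sldInner ρ X Y = sldInner ρ Y X := by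
  rw [sldInner, sldInner, jordan_comm]

theorem sldInner_eq_traceMulRe (ρ X Y : Mat d) :
    sldInner ρ X Y = traceMulRe (jordan ρ X) Y := by
  have h1 : (ρ * (X * Y)).trace = (Y * (ρ * X)).trace := by
    rw [← mul_assoc, Matrix.trace_mul_comm]
  have h2 : (ρ * (Y * X)).trace = (Y * (X * ρ)).trace := by
    rw [Matrix.trace_mul_comm, mul_assoc]
  rw [traceMulRe_apply, sldInner, jordan, jordan, mul_smul_comm, mul_smul_comm, mul_add, mul_add,
    Matrix.trace_smul, Matrix.trace_smul, Matrix.trace_add, Matrix.trace_add, h1, h2]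

theorem trace_jordan_mul_re (ρ X Y : Mat d) :
    (jordan ρ X * Y).trace.re = sldInner ρ X Y := by
  rw [sldInner_eq_traceMulRe, traceMulRe_apply, Matrix.trace_mul_comm]

theorem sldInner_self (ρ X : Mat d) : sldInner ρ X X = (ρ * X ^ 2).trace.re := by
  have : jordan X X = X ^ 2 := by
    rw [jordan, pow_two]
    module
  rw [sldInner, this]

theorem trace_jordan (X Y : Mat d) : (jordan X Y).trace = (X * Y).trace := by
  rw [jordan, Matrix.trace_smul, Matrix.trace_add, Matrix.trace_mul_comm Y X, smul_eq_mul]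
  ring

/-- The map `X ↦ ρ ∘ X` as a real-linear map. -/
def jordanLeft (ρ : Mat d) : Mat d →ₗ[ℝ] Mat d where
  toFun := jordan ρ
  map_add' := by
    intro X Y
    simp only [jordan, mul_add, add_mul]
    module
  map_smul' := by
    intro r X
    simp only [jordan, mul_smul_comm, smul_mul_assoc, RingHom.id_apply, ← smul_add]
    rw [smul_comm]

/-- Pairing with X gives Tr ρX² = 0, and ρ ≥ c > 0 then forces Tr X² = 0. -/
theorem eq_zero_of_jordan_eq_zero {ρ X : Mat d} (hρ : ρ.PosDef) (hX : X.IsHermitian)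
    (h : jordan ρ X = 0) : X = 0 := by
  have h0 : (ρ * X ^ 2).trace.re = 0 := by
    rw [← sldInner_self, ← trace_jordan_mul_re, h, zero_mul, Matrix.trace_zero, Complex.zero_re]
  obtain ⟨c, hc, hp⟩ := exists_pos_posSemidef_sub_smul_one hρ
  have hX2 : (X ^ 2).PosSemidef := by
    have := Matrix.posSemidef_conjTranspose_mul_self X
    rwa [hX.eq, ← pow_two] at this
  have h1 := trace_mul_re_nonneg hp hX2
  rw [sub_mul, Matrix.trace_sub, Complex.sub_re, h0, smul_mul_assoc, one_mul, Matrix.trace_smul,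
    smul_eq_mul, Complex.re_ofReal_mul, zero_sub, neg_nonneg] at h1
  have h2 := Complex.le_def.1 hX2.trace_nonneg
  have h3 : (X ^ 2).trace = 0 :=
    Complex.ext (le_antisymm (nonpos_of_mul_nonpos_right h1 hc) h2.1) h2.2.symm
  have h4 := hX2.trace_eq_zero_iff.1 h3
  rw [pow_two] at h4
  nth_rw 1 [← hX.eq] at h4
  exact Matrix.conjTranspose_mul_self_eq_zero.1 h4

/-- The affine family through `ρs` at `θ₀` with derivatives `D j`. -/
def affineModel (ρs : Mat d) (θ₀ : Param d) (D : Fin (d ^ 2 - 1) → Mat d) (θ : Param d) :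
    Mat d :=
  ρs + ∑ j, (θ j - θ₀ j) • D j

variable {ρs : Mat d} {θ₀ : Param d} {D : Fin (d ^ 2 - 1) → Mat d}

theorem affineModel_base : affineModel ρs θ₀ D θ₀ = ρs := by
  simp [affineModel]

theorem partialMat_affineModel (j : Fin (d ^ 2 - 1)) :
    partialMat (affineModel ρs θ₀ D) θ₀ j = D j := by
  ext a b
  suffices hline : HasLineDerivAt ℝ (fun θ => affineModel ρs θ₀ D θ a b) (D j a b) θ₀
      (coordVec j) from hline.lineDeriv
  have h : ∀ s : ℝ, affineModel ρs θ₀ D (θ₀ + s • coordVec j) a b = ρs a b + s • D j a b := by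
    intro s
    rw [affineModel, Finset.sum_eq_single j]
    · simp [coordVec]
    · intro i _ hi
      simp [coordVec, hi]
    · simp
  have h2 : HasDerivAt (fun s : ℝ => ρs a b + s • D j a b) (D j a b) 0 := by
    simpa using ((hasDerivAt_id (0 : ℝ)).smul_const (D j a b)).const_add (ρs a b)
  exact h2.congr_of_eventuallyEq (Eventually.of_forall h)

/-- Traceless Hermitian directions preserve trace and hermiticity, and positive definiteness
persists near θ₀. -/
theorem isFullModel_affineModel (hρ : ρs.PosDef) (hρ1 : ρs.trace = 1)
    (hD : ∀ j, (D j).IsHermitian) (hD0 : ∀ j, (D j).trace = 0) (hli : LinearIndependent ℝ D) :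
    IsFullModel (affineModel ρs θ₀ D) θ₀ ρs where
  base := affineModel_base
  isState := by
    have hc : Continuous (affineModel ρs θ₀ D) :=
      continuous_const.add (continuous_finsetSum _ fun j _ =>
        ((continuous_apply j).sub continuous_const).smul continuous_const)
    have hH : ∀ θ, (affineModel ρs θ₀ D θ).IsHermitian := fun θ =>
      hρ.isHermitian.add (isSelfAdjoint_sum _ fun j _ => IsSelfAdjoint.smul (.all _) (hD j))
    have hlim := hc.tendsto θ₀
    rw [affineModel_base] at hlim
    filter_upwards [eventually_posDef hρ hlim (Eventually.of_forall hH)] with θ hθ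
    refine ⟨hθ.posSemidef, ?_⟩
    simp [affineModel, Matrix.trace_sum, hD0, hρ1]
  differentiable a b := by
    have : (fun θ => affineModel ρs θ₀ D θ a b)
        = fun θ => ρs a b + ∑ j, (θ j - θ₀ j) • D j a b := by
      ext θ
      simp [affineModel, Matrix.sum_apply]
    rw [this]
    fun_prop
  linearIndependent := by
    have : partialMat (affineModel ρs θ₀ D) θ₀ = D := funext partialMat_affineModel
    rwa [this]

/-- Being centred and being orthogonal to X are two real linear conditions on a d²-dimensional
space. Their kernel has dimension at least d² − 2, the number of indices other than k. -/
theorem exists_linearIndependent_sldInner_eq_zero (ρs X : Mat d) (k : Fin (d ^ 2 - 1)) :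
    ∃ u : {j // j ≠ k} → Mat d, LinearIndependent ℝ u ∧ ∀ j, (u j).IsHermitian ∧
      (ρs * u j).trace.re = 0 ∧ sldInner ρs X (u j) = 0 := by
  let ι : selfAdjoint (Mat d) →ₗ[ℝ] Mat d := (selfAdjoint.submodule ℝ (Mat d)).subtype
  let φ : selfAdjoint (Mat d) →ₗ[ℝ] ℝ × ℝ :=
    (traceMulRe ρs ∘ₗ ι).prod (traceMulRe (jordan ρs X) ∘ₗ ι)
  have hrank := φ.finrank_range_add_finrank_ker
  have hle : Module.finrank ℝ (LinearMap.range φ) ≤ 2 := by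
    simpa using Submodule.finrank_le (LinearMap.range φ)
  rw [finrank_selfAdjoint_mat] at hrank
  have hcard : Fintype.card {j // j ≠ k}
      ≤ Fintype.card (Fin (Module.finrank ℝ (LinearMap.ker φ))) := by
    rw [Fintype.card_fin, Fintype.card_subtype_compl, Fintype.card_fin, Fintype.card_unique]
    omega
  obtain ⟨e⟩ := Function.Embedding.nonempty_of_card_le hcard
  let b := Module.finBasis ℝ (LinearMap.ker φ)
  refine ⟨fun j => ι (b (e j)), ?_, fun j => ?_⟩
  · have h1 := b.linearIndependent.comp e e.injective
    have h2 := h1.map' (LinearMap.ker φ).subtype (Submodule.ker_subtype _)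
    exact h2.map' ι (Submodule.ker_subtype _)
  · have h := LinearMap.mem_ker.1 (b (e j)).2
    refine ⟨(b (e j)).1.2, ?_, ?_⟩
    · rw [Matrix.trace_mul_comm]
      exact congrArg Prod.fst h
    · rw [sldInner_eq_traceMulRe]
      exact congrArg Prod.snd h

theorem exists_linearIndependent_sldInner_dual {X : Mat d} (hX : X.IsHermitian)
    (hX0 : (ρs * X).trace.re = 0) (hV : sldInner ρs X X ≠ 0) (k : Fin (d ^ 2 - 1)) :
    ∃ L : Fin (d ^ 2 - 1) → Mat d, LinearIndependent ℝ L ∧ L k = (sldInner ρs X X)⁻¹ • X ∧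
      ∀ j, (L j).IsHermitian ∧ (ρs * L j).trace.re = 0 ∧
        (j ≠ k → sldInner ρs X (L j) = 0) := by
  obtain ⟨u, hu, hu'⟩ := exists_linearIndependent_sldInner_eq_zero ρs X k
  let v : Option {j // j ≠ k} → Mat d := fun o => o.elim ((sldInner ρs X X)⁻¹ • X) u
  have hv : LinearIndependent ℝ v := by
    -- The functional ⟨X, ·⟩ vanishes on the span of u but takes the value 1 on X/⟨X, X⟩.
    refine linearIndependent_option.2 ⟨hu, fun hmem => ?_⟩
    have hle : Submodule.span ℝ (Set.range (v ∘ some))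
        ≤ LinearMap.ker (traceMulRe (jordan ρs X)) := by
      rw [Submodule.span_le]
      rintro _ ⟨j, rfl⟩
      exact (sldInner_eq_traceMulRe _ _ _).symm.trans (hu' j).2.2
    have h1 : traceMulRe (jordan ρs X) ((sldInner ρs X X)⁻¹ • X) = 0 :=
      LinearMap.mem_ker.1 (hle hmem)
    rw [map_smul, ← sldInner_eq_traceMulRe, smul_eq_mul, inv_mul_cancel₀ hV] at h1
    exact one_ne_zero h1
  let e := Equiv.optionSubtypeNe k
  have hk : e.symm k = none := by simp [e]
  have hj : ∀ j (h : j ≠ k), e.symm j = some ⟨j, h⟩ := fun j h => by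
    simp [e, Equiv.optionSubtypeNe_symm_of_ne h]
  have hvk : v (e.symm k) = (sldInner ρs X X)⁻¹ • X := by rw [hk]; rfl
  refine ⟨v ∘ e.symm, hv.comp _ e.symm.injective, hvk, fun j => ?_⟩
  by_cases h : j = k
  · subst h
    rw [Function.comp_apply, hvk]
    refine ⟨IsSelfAdjoint.smul (.all _) hX, ?_, fun h => (h rfl).elim⟩
    rw [mul_smul_comm, Matrix.trace_smul, Complex.smul_re, hX0, smul_zero]
  · have hvj : v (e.symm j) = u ⟨j, h⟩ := by rw [hj j h]; rfl
    rw [Function.comp_apply, hvj]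
    exact ⟨(hu' _).1, (hu' _).2.1, fun _ => (hu' _).2.2⟩

theorem linearIndependent_jordan {ι : Type*} (hρ : ρs.PosDef) {L : ι → Mat d}
    (hL : ∀ j, (L j).IsHermitian) (hli : LinearIndependent ℝ L) :
    LinearIndependent ℝ fun j => jordan ρs (L j) := by
  refine hli.map (f := jordanLeft ρs) ?_
  rw [Submodule.disjoint_def]
  intro Z hZ hZ0
  refine eq_zero_of_jordan_eq_zero hρ ?_ (LinearMap.mem_ker.1 hZ0)
  have hle : Submodule.span ℝ (Set.range L) ≤ selfAdjoint.submodule ℝ (Mat d) := by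
    rw [Submodule.span_le]
    rintro _ ⟨j, rfl⟩
    exact hL j
  exact hle hZ

/-- Only the real part is assumed to vanish; the imaginary part vanishes because ρ* ∘ L is
Hermitian. -/
theorem trace_jordan_eq_zero {L : Mat d} (hρ : ρs.IsHermitian) (hL : L.IsHermitian)
    (h : (ρs * L).trace.re = 0) : (jordan ρs L).trace = 0 := by
  refine Complex.ext (by rw [trace_jordan, h, Complex.zero_re]) ?_
  have h1 := congrArg Complex.im (congrArg Matrix.trace (isHermitian_jordan hρ hL).eq)
  rw [Matrix.trace_conjTranspose, Complex.star_def, Complex.conj_im] at h1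
  rw [Complex.zero_im]
  linarith

/-- In the affine model with derivatives ρ* ∘ L_j, the partial derivatives of D are ⟨L_j, X⟩.
Adaptedness therefore means duality of the L_j to X, and L_k = X/V makes this the same as
orthogonality to L_k, with ⟨L_k, L_k⟩ = 1/V. -/
theorem exists_adapted_model (hρ : ρs.PosDef) (hρ1 : ρs.trace = 1) (σ : Mat d)
    (hV : relVarentropy ρs σ ≠ 0) (k : Fin (d ^ 2 - 1)) :
    ∃ (ρ : Param d → Mat d) (θ₀ : Param d) (L : Fin (d ^ 2 - 1) → Mat d),
      IsFullModel ρ θ₀ ρs ∧ IsAdapted ρ θ₀ (fun τ => relEntropy τ σ) k ∧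
      IsSLD ρ θ₀ L ∧ (∀ j, j ≠ k → sldInner ρs (L k) (L j) = 0) ∧
      (sldInner ρs (L k) (L k))⁻¹ = relVarentropy ρs σ := by
  set X := centredLogRatio ρs σ
  have hX : X.IsHermitian := isHermitian_centredLogRatio ρs σ
  have hVX : sldInner ρs X X = relVarentropy ρs σ := sldInner_self ρs X
  rw [← hVX] at hV ⊢
  obtain ⟨L, hli, hLk, hL⟩ := exists_linearIndependent_sldInner_dual hX
    (trace_mul_centredLogRatio hρ1 σ) hV k
  set θ₀ : Param d := Pi.single k (relEntropy ρs σ)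
  have hfull : IsFullModel (affineModel ρs θ₀ fun j => jordan ρs (L j)) θ₀ ρs :=
    isFullModel_affineModel hρ hρ1 (fun j => isHermitian_jordan hρ.isHermitian (hL j).1)
      (fun j => trace_jordan_eq_zero hρ.isHermitian (hL j).1 (hL j).2.1)
      (linearIndependent_jordan hρ (fun j => (hL j).1) hli)
  have hsmul : ∀ Y, sldInner ρs (L k) Y = (sldInner ρs X X)⁻¹ * sldInner ρs X Y := by
    intro Y
    rw [sldInner_comm, sldInner_eq_traceMulRe, hLk, map_smul, ← sldInner_eq_traceMulRe,
      sldInner_comm ρs Y, smul_eq_mul]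
  have hder : ∀ j, HasLineDerivAt ℝ
      (fun θ => relEntropy (affineModel ρs θ₀ (fun j => jordan ρs (L j)) θ) σ)
      (sldInner ρs (L j) X) θ₀ (coordVec j) := by
    intro j
    have := hfull.hasLineDerivAt_relEntropy_centred hρ σ j
    rwa [partialMat_affineModel, trace_jordan_mul_re] at this
  refine ⟨_, θ₀, L, hfull, ⟨?_, ?_, fun j hj => ?_⟩, fun j => ⟨(hL j).1, ?_⟩, fun j hj => ?_, ?_⟩
  · rw [affineModel_base]
  · have := hder k
    rwa [hsmul, inv_mul_cancel₀ hV] at this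
  · have := hder j
    rwa [sldInner_comm, (hL j).2.2 hj] at this
  · rw [partialMat_affineModel, affineModel_base]
  · rw [hsmul, (hL j).2.2 hj, mul_zero]
  · rw [hsmul, sldInner_comm ρs X (L k), hsmul, inv_mul_cancel₀ hV, mul_one, inv_inv]

end SymmetricLogarithmicDerivative

end QRelEnt

end

theorem mainTheorem2 (d : ℕ) (ρs σ : Matrix (Fin d) (Fin d) ℂ)
    (hρ : ρs.PosDef) (hρ1 : ρs.trace = 1) (hσ : σ.PosDef) (hσ1 : σ.trace = 1) :
    -- The bound for the function `D(ρ‖σ)` in any full-parameter model, and its attainment.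
    (∀ (ρ : Param d → Mat d) (θ₀ : Param d), IsFullModel ρ θ₀ ρs →
      crBound ρ θ₀ (fun θ => relEntropy (ρ θ) σ) = ENNReal.ofReal (relVarentropy ρs σ) ∧
      ENNReal.ofReal (relVarentropy ρs σ) ∈
        achievableMSE ρ θ₀ (fun θ => relEntropy (ρ θ) σ)) ∧
    -- The bound for the parameter of interest, the other parameters being nuisance parameters.
    (∀ (ρ : Param d → Mat d) (θ₀ : Param d) (k : Fin (d ^ 2 - 1)), IsFullModel ρ θ₀ ρs →
      IsAdapted ρ θ₀ (fun τ => relEntropy τ σ) k →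
      crBound ρ θ₀ (fun θ => θ k) = ENNReal.ofReal (relVarentropy ρs σ) ∧
      ENNReal.ofReal (relVarentropy ρs σ) ∈ achievableMSE ρ θ₀ (fun θ => θ k)) ∧
    -- Adapted parameterizations with orthogonal parameter of interest exist.
    (relVarentropy ρs σ ≠ 0 → ∀ k : Fin (d ^ 2 - 1),
      ∃ (ρ : Param d → Mat d) (θ₀ : Param d) (L : Fin (d ^ 2 - 1) → Mat d),
        IsFullModel ρ θ₀ ρs ∧ IsAdapted ρ θ₀ (fun τ => relEntropy τ σ) k ∧
        IsSLD ρ θ₀ L ∧ (∀ j, j ≠ k → sldInner ρs (L k) (L j) = 0) ∧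
        (sldInner ρs (L k) (L k))⁻¹ = relVarentropy ρs σ) := by
  refine ⟨fun ρ θ₀ h => ?_, fun ρ θ₀ k h hk => ?_, fun hV k => exists_adapted_model hρ hρ1 σ hV k⟩
  · have hX := isHermitian_centredLogRatio ρs σ
    have hX0 := trace_mul_centredLogRatio hρ1 σ
    have hg := h.hasLineDerivAt_relEntropy_centred hρ σ
    exact ⟨h.crBound_eq hρ hX hX0 hg, h.mem_achievableMSE hX hX0 hg⟩
  · have hX := isHermitian_centredLogRatio ρs σ
    have hX0 := trace_mul_centredLogRatio hρ1 σ
    -- Adaptedness says that θ^k and D(ρ_θ‖σ) have the same partial derivatives at θ₀, so the same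
    -- observable X represents both.
    have hg : ∀ j, HasLineDerivAt ℝ (fun θ : Param d => θ k)
        (partialMat ρ θ₀ j * centredLogRatio ρs σ).trace.re θ₀ (coordVec j) := by
      intro j
      have hcoord : HasLineDerivAt ℝ (fun θ : Param d => θ k) (coordVec j k) θ₀ (coordVec j) :=
        (ContinuousLinearMap.proj (R := ℝ) (φ := fun _ => ℝ) k).hasFDerivAt.hasLineDerivAt _
      have hrel := h.hasLineDerivAt_relEntropy_centred hρ σ j
      by_cases hj : j = k
      · subst hj
        rw [hrel.unique hk.deriv_self]
        simpa [coordVec] using hcoord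
      · rw [hrel.unique (hk.deriv_other j hj)]
        simpa [coordVec, Ne.symm hj] using hcoord
    exact ⟨h.crBound_eq hρ hX hX0 hg, h.mem_achievableMSE hX hX0 hg⟩
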